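/- **Theorem (Switching regret).** There are absolute constants $C>0$ and $k\in\mathbb N$ such that the following holds. Let $d\in\mathbb N$, $G>0$, $T\in\mathbb N_+$, and $u_1,\dots,u_T\in\mathbb R^d$. Consider online convex optimization on $\mathbb R^d$: in round $t$ the player predicts $x_t\in\mathbb R^d$, and an adaptive environment $\mathcal E$ chooses (knowing $x_1,\dots,x_t$) a convex loss $l_t:\mathbb R^d\to\mathbb R$ that is $G$-Lipschitz for the Euclidean norm and reveals a subgradient $g_t\in\partial l_t(x_t)$. Let $\mathrm{Reg}_T(u_{1:T})=\sup_{\mathcal E}\big[\sum_{t=1}^T l_t(x_t)-\sum_{t=1}^T l_t(u_t)\big]$. Then the anytime Haar OLR algorithm defined below, which knows $G$ but neither $T$ nor $u_{1:T}$, satisfies $$\mathrm{Reg}_T(u_{1:T})\le C\,G\log(T+1)+C\,G\left(\|\bar u\|_2\sqrt T+\sqrt{K\bar E}\right)\big(1+\log T+\log(1+M)\big)^k ,$$ where $\bar u=\frac1T\sum_{t=1}^T u_t$, $K=\sum_{t=1}^{T-1}\mathbf 1[u_{t+1}\ne u_t]$, $\bar E=\sum_{t=1}^T\|u_t-\bar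 u\|_2^2$ and $M=\max_{1\le t\le T}\|u_t\|_2$; that is, $\mathrm{Reg}_T(u_{1:T})\le\tilde O\big(\|\bar u\|_2\sqrt T+\sqrt{K\bar E}\big)$. *FreeGrad* with hyperparameter $\varepsilon$ and Lipschitz constant $G$ keeps $s$, the sum of the gradients received so far, and $v=G^2+\sum\|g\|_2^2$ over these gradients, and outputs $$\hat x=-\varepsilon s\cdot\frac{(2v+G\|s\|_2)G^2}{2(v+G\|s\|_2)^2\sqrt v}\exp\!\left(\frac{\|s\|_2^2}{2v+2G\|s\|_2}\right).$$ *Haar OLR with horizon $2^m$* uses $2^m$ scalar features on $t\in\{1,\dots,2^m\}$: the all-one feature and, for $1\le j\le m$, $1\le l\le 2^{m-j}$, the feature $h^{(j,l)}$ equal to $1$ on the first half and $-1$ on the second half of $\{2^j(l-1)+1,\dots,2^jl\}$ and $0$ elsewhere. Each feature $h$ has its own copy of $d$-dimensional FreeGrad with hyperparameter $\varepsilon/2^m$ and Lipschitz constant $G$; in round $t$ the prediction is the sum over the features with $h_t\ne0$ of $h_t\hat x_t$, where $\hat x_t$ is the output of the feature's copy, and each of these copies then receives the surrogate gradient $h_tg_t$.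 *Anytime Haar OLR* runs, for $m=1,2,\dots$ successively, a fresh copy of Haar OLR with horizon $2^m$ and $\varepsilon=1$ for $2^m$ rounds. -/

import Mathlib

noncomputable section

open scoped NNReal

/-- The decision space `ℝ^d` with the Euclidean norm. -/
abbrev Vec (d : ℕ) : Type := EuclideanSpace ℝ (Fin d)

/-- A deterministic online algorithm with gradient feedback: it maps the chronological list
`[g_1, …, g_{t-1}]` of the gradients observed so far to the prediction `x_t`. -/
abbrev OnlineAlgorithm (d : ℕ) : Type := List (Vec d) → Vec d

/-! ### The game -/

/-- An adaptive environment. With `past = [x_1, …, x_{t-1}]` and `x = x_t`, the function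
`loss past x` is the convex `G`-Lipschitz loss `l_t` of round `t`, and `grad past x` is the
subgradient `g_t ∈ ∂ l_t(x_t)` that is revealed to the player. -/
structure Environment (d : ℕ) (G : ℝ≥0) where
  loss : List (Vec d) → Vec d → Vec d → ℝ
  grad : List (Vec d) → Vec d → Vec d
  convex : ∀ past x, ConvexOn ℝ Set.univ (loss past x)
  lipschitz : ∀ past x, LipschitzWith G (loss past x)
  subgradient : ∀ past x y, loss past x x + inner ℝ (grad past x) (y - x) ≤ loss past x y

/-- The first `t` rounds of the game: the lists `[x_1, …, x_t]` of predictions and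
`[g_1, …, g_t]` of revealed gradients. -/
def play {d : ℕ} {G : ℝ≥0} (A : OnlineAlgorithm d) (env : Environment d G) :
    ℕ → List (Vec d) × List (Vec d)
  | 0 => ([], [])
  | t + 1 =>
    let xs := (play A env t).1
    let gs := (play A env t).2
    (xs ++ [A gs], gs ++ [env.grad xs (A gs)])

/-- The prediction `x_t` of round `t = 1, 2, …`. -/
def prediction {d : ℕ} {G : ℝ≥0} (A : OnlineAlgorithm d) (env : Environment d G) (t : ℕ) : Vec d :=
  A (play A env (t - 1)).2

/-- The loss function `l_t` of round `t = 1, 2, …`. -/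
def roundLoss {d : ℕ} {G : ℝ≥0} (A : OnlineAlgorithm d) (env : Environment d G) (t : ℕ) :
    Vec d → ℝ :=
  env.loss (play A env (t - 1)).1 (prediction A env t)

/-- The unconstrained dynamic regret
`Reg_T(u_{1:T}) = sup_env [∑_{t=1}^T l_t(x_t) - ∑_{t=1}^T l_t(u_t)]`, as an extended real. -/
def dynamicRegret {d : ℕ} (A : OnlineAlgorithm d) (G : ℝ≥0) (T : ℕ) (u : ℕ → Vec d) : EReal :=
  ⨆ env : Environment d G,
    ((∑ t ∈ Finset.Icc 1 T, roundLoss A env t (prediction A env t)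
      - ∑ t ∈ Finset.Icc 1 T, roundLoss A env t (u t) : ℝ) : EReal)

/-! ### The algorithm -/

/-- The FreeGrad prediction in dimension `d` with hyperparameter `ε` and Lipschitz constant `G`, as
a function of the gradient sum `s` and the variance counter `v`. -/
def freeGradPrediction {d : ℕ} (ε G : ℝ) (s : Vec d) (v : ℝ) : Vec d :=
  (-(ε * ((2 * v + G * ‖s‖) * G ^ 2 / (2 * (v + G * ‖s‖) ^ 2 * √v))
      * Real.exp (‖s‖ ^ 2 / (2 * v + 2 * G * ‖s‖)))) • s

/-- FreeGrad: its state after observing the gradients in `gs` is `s = ∑ g` and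
`v = G ^ 2 + ∑ ‖g‖ ^ 2`. -/
def freeGrad {d : ℕ} (ε G : ℝ) : OnlineAlgorithm d := fun gs =>
  freeGradPrediction ε G gs.sum (G ^ 2 + (gs.map fun g => ‖g‖ ^ 2).sum)

/-- The Haar feature `h^{(j,l)}_t` of scale `j ≥ 1` and location `l ≥ 1` at time `t ≥ 1`. -/
def haarFeature (j l t : ℕ) : ℝ :=
  if t ∈ Finset.Icc (2 ^ j * (l - 1) + 1) (2 ^ j * (l - 1) + 2 ^ (j - 1)) then 1
  else if t ∈ Finset.Icc (2 ^ j * (l - 1) + 2 ^ (j - 1) + 1) (2 ^ j * l) then -1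
  else 0

/-- The surrogate gradients `h_i • g_i` that are sent to the FreeGrad copy of a scalar feature
`h = (h_1, h_2, …)`, one for each past round `i` with `h_i ≠ 0`. -/
def surrogateGradients {d : ℕ} (h : ℕ → ℝ) (gs : List (Vec d)) : List (Vec d) :=
  (gs.zipIdx 1).filterMap fun p => if h p.2 = 0 then none else some (h p.2 • p.1)

/-- The contribution `w_t = h_t • x̂_t` of the feature `h` in round `t = gs.length + 1`, where
`x̂_t` is the output of the FreeGrad copy of this feature (irrelevant when `h_t = 0`). -/
def featureLearner {d : ℕ} (ε G : ℝ) (h : ℕ → ℝ) : OnlineAlgorithm d := fun gs =>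
  h (gs.length + 1) • freeGrad ε G (surrogateGradients h gs)

/-- Haar OLR for the known horizon `2 ^ m`: the dictionary consists of the all-one feature and the
Haar features of scales `j ∈ [1 : m]` and locations `l ∈ [1 : 2 ^ (m - j)]`, so it has
`N = 2 ^ m` features; each of them runs `d`-dimensional FreeGrad with hyperparameter `ε / N`. -/
def haarOLR {d : ℕ} (m : ℕ) (ε G : ℝ) : OnlineAlgorithm d := fun gs =>
  featureLearner (ε / 2 ^ m) G (fun _ => 1) gs
    + ∑ j ∈ Finset.Icc 1 m, ∑ l ∈ Finset.Icc 1 (2 ^ (m - j)),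
        featureLearner (ε / 2 ^ m) G (haarFeature j l) gs

/-- Anytime Haar OLR: for `m = 1, 2, …` a fresh copy of `haarOLR m` with hyperparameter `1` is run
for `2 ^ m` rounds. The blocks before block `m` last `2 + 4 + ⋯ + 2 ^ (m - 1) = 2 ^ m - 2` rounds,
so the block of the round that follows `p` past rounds is the `m` with
`2 ^ m ≤ p + 2 < 2 ^ (m + 1)`. -/
def anytimeHaarOLR {d : ℕ} (G : ℝ) : OnlineAlgorithm d := fun gs =>
  let m := Nat.log 2 (gs.length + 2)
  haarOLR m 1 G (gs.drop (2 ^ m - 2))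

/-! ### Statistics of the comparator sequence `u_1, …, u_T` -/

/-- Comparator average `ū`. -/
def comparatorAverage {d : ℕ} (T : ℕ) (u : ℕ → Vec d) : Vec d :=
  (T : ℝ)⁻¹ • ∑ t ∈ Finset.Icc 1 T, u t

open Classical in
/-- Number of switches `K`. -/
def numSwitches {d : ℕ} (T : ℕ) (u : ℕ → Vec d) : ℕ :=
  ∑ t ∈ Finset.Icc 1 (T - 1), if u (t + 1) ≠ u t then 1 else 0

/-- Second order variability `Ē`. -/
def secondOrderVariability {d : ℕ} (T : ℕ) (u : ℕ → Vec d) : ℝ :=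
  ∑ t ∈ Finset.Icc 1 T, ‖u t - comparatorAverage T u‖ ^ 2

/-- Maximum range `M = max_t ‖u_t‖`. -/
def maxRange {d : ℕ} (T : ℕ) (u : ℕ → Vec d) : ℝ≥0 :=
  (Finset.Icc 1 T).sup fun t => ‖u t‖₊

end

noncomputable section

open scoped NNReal

/-! ### The FreeGrad potential -/

/-! By convexity each loss difference is at most `⟨g_t, x_t - u_t⟩` with `‖g_t‖ ≤ G`, so linear
losses suffice. Linear regret is additive: once the comparator is expanded in the features, the
regret is the sum, over the features, of the regret of each FreeGrad copy against its own
coefficient `w`.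

One copy: FreeGrad plays the negative gradient in `s` of a potential of the form `exp(‖s‖² / (2v +
2G‖s‖)) / √v`, up to a constant factor. The analytic core, `freeGradPotential_step`, says that the
loss of a round is at most the drop of the potential. Telescoping and a duality argument
(`mul_sub_unitPotential_le`) turn this into regret `εG + O(G (1 + l) ‖w‖ √N)`, where `N` bounds the
ℓ¹ mass of the feature and `l` is logarithmic (`featureLearner_regret`). A feature with `w = 0`
costs only `εG`, and these costs add up to a constant because `ε` is divided by the number of
features.

Haar: split the comparator into its global average `ū` and the deviation from it. A Haar coefficient
of the deviation vanishes unless a switch occurs in its dyadic interval, so at each scale `O(K)`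
coefficients survive, and Cauchy–Schwarz bounds their cost by `√(K Ē)` up to constants
(`sum_norm_haarCoeff_mul_sqrt_le`). The constant part costs `‖ū‖√T`. The number of scales, the
factor `1 + l` and the number of doubling blocks each contribute one logarithmic factor; centring
every block at the same `ū` makes the block bounds uniform. -/

/-- This is `y ≤ sinh y` at `y = -log w ≥ 0`. -/
theorem Real.half_sub_inv_le_log {w : ℝ} (hw : 0 < w) (hw1 : w ≤ 1) :
    (w - w⁻¹) / 2 ≤ Real.log w := by
  have h := Real.self_le_sinh_iff.2 (neg_nonneg.2 (Real.log_nonpos hw.le hw1))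
  rw [Real.sinh_eq, neg_neg, Real.exp_neg, Real.exp_log hw] at h
  linarith

/-- With `a = x / (v + x)`, the quantity `a(2 - a)/2` is the derivative in `x` of the exponent `x² /
(2(v + x))`. The lemma replaces the logarithm of the linearised potential by a rational expression.
-/
theorem sub_sq_le_log_one_add {a c : ℝ} (ha : 0 ≤ a) (ha1 : a ≤ 1) (hc : -1 ≤ c) :
    c * (a * (2 - a) / 2) - c ^ 2 * a ^ 2 / 2 ≤ Real.log (1 + c * (a * (2 - a) / 2)) := by
  set L := a * (2 - a) / 2 with hL
  have hL0 : 0 ≤ L := by rw [hL]; nlinarith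
  have hL1 : L ≤ 1 / 2 := by rw [hL]; nlinarith [sq_nonneg (1 - a)]
  have hLa : L ^ 2 = a ^ 2 * ((2 - a) ^ 2 / 4) := by rw [hL]; ring
  rcases le_total 0 c with h0 | h0
  · have hz : 0 ≤ c * L := mul_nonneg h0 hL0
    refine le_trans ?_ (Real.le_log_one_add_of_nonneg hz)
    have h1 : c * L - (c * L) ^ 2 / 2 ≤ 2 * (c * L) / (c * L + 2) := by
      rw [le_div_iff₀ (by linarith)]
      nlinarith [pow_nonneg hz 3]
    have h2 : (c * L) ^ 2 ≤ c ^ 2 * a ^ 2 := by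
      rw [mul_pow, hLa]
      exact mul_le_mul_of_nonneg_left
        (mul_le_of_le_one_right (sq_nonneg a) (by nlinarith)) (sq_nonneg c)
    linarith
  · have hz : c * L ≤ 0 := mul_nonpos_of_nonpos_of_nonneg h0 hL0
    have hzL : -L ≤ c * L := by nlinarith
    have hpos : 0 < 1 + c * L := by linarith
    refine le_trans ?_ (Real.half_sub_inv_le_log hpos (by linarith))
    have h1 : (1 + c * L - (1 + c * L)⁻¹) / 2 = c * L - (c * L) ^ 2 / (1 + c * L) / 2 := by
      field_simp
      ring
    rw [h1]
    -- The denominator is absorbed by the slack in `L² = a²(2 - a)²/4`, since `(2 - a)²/4 ≤ 1 - L ≤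
    -- 1 + cL`.
    have h2 : (c * L) ^ 2 / (1 + c * L) ≤ c ^ 2 * a ^ 2 := by
      rw [div_le_iff₀ hpos, mul_pow, hLa, mul_assoc]
      refine mul_le_mul_of_nonneg_left (mul_le_mul_of_nonneg_left ?_ (sq_nonneg a)) (sq_nonneg c)
      have : (2 - a) ^ 2 / 4 ≤ 1 - L := by rw [hL]; nlinarith
      linarith
    linarith

/-- The gap between the two sides factors exactly into terms that are visibly nonnegative. This is
the case where a gradient parallel to `s` does not push the sum through the origin. -/
theorem freeGrad_rational_of_nonneg_add {v x c : ℝ} (hv : 1 ≤ v) (hx : 0 ≤ x) (hc : -1 ≤ c)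
    (hc1 : c ≤ 1) (hxc : 0 ≤ x + c) :
    -(c ^ 2 / (2 * v + c ^ 2)) + (x + c) ^ 2 / (2 * (v + c ^ 2 + (x + c))) - x ^ 2 / (2 * (v + x))
      ≤ c * (x / (v + x) * (2 - x / (v + x)) / 2) - c ^ 2 * (x / (v + x)) ^ 2 / 2 := by
  have hp : 0 < v + x := by linarith
  have hD : 0 < v + c ^ 2 + (x + c) := by nlinarith [sq_nonneg c]
  have hq : 0 < 2 * v + c ^ 2 := by nlinarith [sq_nonneg c]
  set a := x / (v + x) with ha
  have ha0 : 0 ≤ a := by positivity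
  have ha1 : a ≤ 1 := by rw [ha, div_le_one hp]; linarith
  have key : c * (a * (2 - a) / 2) - c ^ 2 * a ^ 2 / 2 - (-(c ^ 2 / (2 * v + c ^ 2))
      + (x + c) ^ 2 / (2 * (v + c ^ 2 + (x + c))) - x ^ 2 / (2 * (v + x)))
      = c ^ 2 / (2 * (v + c ^ 2 + (x + c))) *
        ((2 * (x + c) + c ^ 2) / (2 * v + c ^ 2) + (1 + c) * (a * (2 - a - a * c))) := by
    rw [ha]
    field_simp
    ring
  have h1 : 0 ≤ (1 + c) * (a * (2 - a - a * c)) :=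
    mul_nonneg (by linarith) (mul_nonneg ha0 (by nlinarith))
  have h2 : 0 ≤ (2 * (x + c) + c ^ 2) / (2 * v + c ^ 2) := by positivity
  have h3 : 0 ≤ c ^ 2 / (2 * (v + c ^ 2 + (x + c))) := by positivity
  have := mul_nonneg h3 (add_nonneg h2 h1)
  linarith

/-- The overshooting case `c = -b` with `x ≤ b`, where the sum changes sign. After clearing `2(v +
x)`, two fractions must be compared; the cases follow the signs of their numerators `b² - 2x` and
`b² + b - 2x`. -/
theorem freeGrad_rational_of_add_nonpos {v x b : ℝ} (hv : 1 ≤ v) (hx : 0 ≤ x) (hb1 : b ≤ 1)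
    (hxb : x ≤ b) :
    -(b ^ 2 / (2 * v + b ^ 2)) + (b - x) ^ 2 / (2 * (v + b ^ 2 + (b - x))) - x ^ 2 / (2 * (v + x))
      ≤ -b * (x / (v + x) * (2 - x / (v + x)) / 2) - b ^ 2 * (x / (v + x)) ^ 2 / 2 := by
  have hb : 0 ≤ b := hx.trans hxb
  have hp : 0 < v + x := by linarith
  have hD : 0 < v + b ^ 2 + (b - x) := by nlinarith [sq_nonneg b]
  have hq : 0 < 2 * v + b ^ 2 := by nlinarith [sq_nonneg b]
  have key : -b * (x / (v + x) * (2 - x / (v + x)) / 2) - b ^ 2 * (x / (v + x)) ^ 2 / 2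
      - (-(b ^ 2 / (2 * v + b ^ 2)) + (b - x) ^ 2 / (2 * (v + b ^ 2 + (b - x)))
        - x ^ 2 / (2 * (v + x)))
      = (2 * (v + x))⁻¹ * ((b - x) ^ 2 * (b ^ 2 + b - 2 * x) / (v + b ^ 2 + (b - x))
        - b ^ 2 * (b ^ 2 - 2 * x) / (2 * v + b ^ 2) + b * (1 - b) * x ^ 2 / (v + x)) := by
    field_simp
    ring
  have h1 : 0 ≤ b * (1 - b) * x ^ 2 / (v + x) :=
    div_nonneg (mul_nonneg (mul_nonneg hb (by linarith)) (sq_nonneg x)) hp.le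
  have h2 : b ^ 2 * (b ^ 2 - 2 * x) / (2 * v + b ^ 2)
      ≤ (b - x) ^ 2 * (b ^ 2 + b - 2 * x) / (v + b ^ 2 + (b - x)) := by
    rw [div_le_div_iff₀ hq hD]
    rcases le_total (b ^ 2) (2 * x) with h | h
    · rcases le_total (2 * x) (b ^ 2 + b) with h' | h'
      · have e1 : b ^ 2 * (b ^ 2 - 2 * x) * (v + b ^ 2 + (b - x)) ≤ 0 :=
          mul_nonpos_of_nonpos_of_nonneg
            (mul_nonpos_of_nonneg_of_nonpos (sq_nonneg b) (by linarith)) hD.le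
        have e2 : 0 ≤ (b - x) ^ 2 * (b ^ 2 + b - 2 * x) * (2 * v + b ^ 2) :=
          mul_nonneg (mul_nonneg (sq_nonneg _) (by linarith)) hq.le
        linarith
      -- Both numerators are nonpositive here; `2x ≥ b² + b` forces `x ≥ b/2`, hence `(b - x)² ≤
      -- b²/4`.
      · have e1 : (b - x) ^ 2 * (2 * x - b ^ 2 - b) ≤ b ^ 2 / 4 * (2 * x - b ^ 2) := by
          refine mul_le_mul ?_ (by linarith) (by linarith) (by positivity)
          nlinarith
        have e2 : (b - x) ^ 2 * (2 * x - b ^ 2 - b) * (2 * v + b ^ 2)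
            ≤ b ^ 2 / 4 * (2 * x - b ^ 2) * (4 * (v + b ^ 2 + (b - x))) := by
          refine mul_le_mul e1 (by nlinarith) hq.le ?_
          exact mul_nonneg (by positivity) (by linarith)
        linarith
    · have e1 : b ^ 2 - 2 * x ≤ (b - x) ^ 2 := by nlinarith
      have e2 : b ^ 2 * (v + b ^ 2 + (b - x)) ≤ (b ^ 2 + b - 2 * x) * (2 * v + b ^ 2) :=
        mul_le_mul (by nlinarith) (by linarith) hD.le (by linarith)
      have e3 := mul_le_mul e1 e2 (by positivity) (sq_nonneg _)
      linarith
  have := mul_nonneg (inv_nonneg.2 (by linarith : 0 ≤ 2 * (v + x)))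
    (add_nonneg (sub_nonneg.2 h2) h1)
  linarith

theorem freeGrad_rational {v x c : ℝ} (hv : 1 ≤ v) (hx : 0 ≤ x) (hc : -1 ≤ c) (hc1 : c ≤ 1) :
    -(c ^ 2 / (2 * v + c ^ 2)) + |x + c| ^ 2 / (2 * (v + c ^ 2 + |x + c|)) - x ^ 2 / (2 * (v + x))
      ≤ c * (x / (v + x) * (2 - x / (v + x)) / 2) - c ^ 2 * (x / (v + x)) ^ 2 / 2 := by
  rcases le_total 0 (x + c) with h | h
  · rw [abs_of_nonneg h]
    exact freeGrad_rational_of_nonneg_add hv hx hc hc1 h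
  · have := freeGrad_rational_of_add_nonpos (b := -c) hv hx (by linarith) (by linarith)
    rw [abs_of_nonpos h]
    have e : -(x + c) = -c - x := by ring
    rw [e]
    simpa using this

/-- The logarithmic form of the one-step decrease of the FreeGrad potential. -/
theorem freeGrad_log_potential_step {v x c q r : ℝ} (hv : 1 ≤ v) (hx : 0 ≤ x) (hcq : c ^ 2 ≤ q)
    (hq : q ≤ 1) (hr : 0 ≤ r) (hrx : r ^ 2 = x ^ 2 + 2 * (c * x) + q) :
    r ^ 2 / (2 * (v + q + r)) - Real.log (v + q) / 2 ≤
      x ^ 2 / (2 * (v + x)) - Real.log v / 2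
        + Real.log (1 + c * (x * (2 * v + x) / (2 * (v + x) ^ 2))) := by
  have hc := abs_le.1 ((sq_le_one_iff_abs_le_one c).1 (hcq.trans hq))
  have hq0 : 0 ≤ q := (sq_nonneg c).trans hcq
  have hp : 0 < v + x := by linarith
  have hvc : 0 < v + c ^ 2 := by nlinarith [sq_nonneg c]
  -- `ρ` is the new norm if only the component of the gradient along `s` is kept. The orthogonal
  -- energy `q - c²` raises the exponent by at most `(q - c²) / (2(v + q))`, which the growth of
  -- `log v / 2` pays for, so the step reduces to dimension one.
  set ρ := |x + c| with hρ
  have hρ0 : 0 ≤ ρ := abs_nonneg _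
  have hr2 : r ^ 2 = ρ ^ 2 + (q - c ^ 2) := by rw [hρ, sq_abs, hrx]; ring
  have hρr : ρ ≤ r := abs_le_of_sq_le_sq (by rw [hr2, hρ, sq_abs]; linarith) hr
  have h1 : r ^ 2 / (2 * (v + q + r)) ≤
      ρ ^ 2 / (2 * (v + c ^ 2 + ρ)) + (q - c ^ 2) / (v + q) / 2 := by
    have e1 : r ^ 2 / (2 * (v + q + r)) ≤ r ^ 2 / (2 * (v + q + ρ)) := by gcongr
    have e2 : ρ ^ 2 / (2 * (v + q + ρ)) ≤ ρ ^ 2 / (2 * (v + c ^ 2 + ρ)) := by gcongr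
    have e3 : (q - c ^ 2) / (2 * (v + q + ρ)) ≤ (q - c ^ 2) / ((v + q) * 2) := by
      apply div_le_div_of_nonneg_left (by linarith) (by linarith) (by linarith)
    rw [div_div]
    have e4 : r ^ 2 / (2 * (v + q + ρ)) =
        ρ ^ 2 / (2 * (v + q + ρ)) + (q - c ^ 2) / (2 * (v + q + ρ)) := by rw [hr2, add_div]
    linarith
  have h2 : (q - c ^ 2) / (v + q) ≤ Real.log (v + q) - Real.log (v + c ^ 2) := by
    have := Real.one_sub_inv_le_log_of_pos (x := (v + q) / (v + c ^ 2)) (by positivity)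
    rw [Real.log_div (by positivity) (by positivity)] at this
    refine le_trans (le_of_eq ?_) this
    have : v + q ≠ 0 := by positivity
    field_simp
    ring
  have h3 : 2 * (c ^ 2 / (2 * v + c ^ 2)) ≤ Real.log (v + c ^ 2) - Real.log v := by
    have := Real.le_log_one_add_of_nonneg (x := c ^ 2 / v) (by positivity)
    rw [← Real.log_div (by positivity) (by positivity)]
    have e : (v + c ^ 2) / v = 1 + c ^ 2 / v := by field_simp
    rw [e]
    refine le_trans (le_of_eq ?_) this
    field_simp
    ring
  have h4 := freeGrad_rational hv hx hc.1 hc.2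
  have h5 := sub_sq_le_log_one_add (a := x / (v + x)) (c := c) (by positivity)
    ((div_le_one hp).2 (by linarith)) hc.1
  have e : x / (v + x) * (2 - x / (v + x)) / 2 = x * (2 * v + x) / (2 * (v + x) ^ 2) := by
    field_simp
    ring
  rw [e] at h4 h5
  linarith

/-- The FreeGrad potential for Lipschitz constant one. -/
def unitPotential (x v : ℝ) : ℝ := Real.exp (x ^ 2 / (2 * (v + x))) / √v

theorem unitPotential_eq_exp {v : ℝ} (x : ℝ) (hv : 0 < v) :
    unitPotential x v = Real.exp (x ^ 2 / (2 * (v + x)) - Real.log v / 2) := by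
  rw [unitPotential, Real.exp_sub, Real.sqrt_eq_rpow, Real.rpow_def_of_pos hv]
  congr 2
  ring

theorem unitPotential_step {v x c q r : ℝ} (hv : 1 ≤ v) (hx : 0 ≤ x) (hcq : c ^ 2 ≤ q)
    (hq : q ≤ 1) (hr : 0 ≤ r) (hrx : r ^ 2 = x ^ 2 + 2 * (c * x) + q) :
    unitPotential r (v + q) ≤
      unitPotential x v * (1 + c * (x * (2 * v + x) / (2 * (v + x) ^ 2))) := by
  have hc := abs_le.1 ((sq_le_one_iff_abs_le_one c).1 (hcq.trans hq))
  have hq0 : 0 ≤ q := (sq_nonneg c).trans hcq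
  have hL : x * (2 * v + x) / (2 * (v + x) ^ 2) < 1 := by
    rw [div_lt_one (by positivity)]
    nlinarith
  have hL0 : 0 ≤ x * (2 * v + x) / (2 * (v + x) ^ 2) := by positivity
  have hpos : 0 < 1 + c * (x * (2 * v + x) / (2 * (v + x) ^ 2)) := by nlinarith
  rw [unitPotential_eq_exp _ (by linarith), unitPotential_eq_exp _ (by linarith)]
  refine (Real.exp_le_exp.2 (freeGrad_log_potential_step hv hx hcq hq hr hrx)).trans ?_
  rw [Real.exp_add, Real.exp_log hpos]

/-- Here `c` is the component of `g` along `s` in units of `G`; for `s = 0` the direction is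
arbitrary and `c = 0` serves. -/
theorem exists_cos_mul_norm {d : ℕ} {G : ℝ} (hG : 0 < G) (g s : Vec d) :
    ∃ c : ℝ, c * (‖s‖ / G) = inner ℝ g s / G ^ 2 ∧ c ^ 2 ≤ ‖g‖ ^ 2 / G ^ 2 := by
  rcases eq_or_ne s 0 with rfl | hs
  · exact ⟨0, by simp, by simp; positivity⟩
  · have hs' : 0 < ‖s‖ := norm_pos_iff.2 hs
    refine ⟨inner ℝ g s / (‖s‖ * G), by field_simp, ?_⟩
    have h := sq_le_sq.2 ((abs_real_inner_le_norm g s).trans (le_abs_self _))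
    rw [div_pow, mul_pow, div_le_div_iff₀ (by positivity) (by positivity)]
    rw [mul_pow] at h
    nlinarith [mul_le_mul_of_nonneg_right h (sq_nonneg G)]

/-- The FreeGrad potential; FreeGrad predicts its negative gradient in `s`. -/
def freeGradPotential {d : ℕ} (ε G : ℝ) (s : Vec d) (v : ℝ) : ℝ :=
  ε * G * unitPotential (‖s‖ / G) (v / G ^ 2)

theorem freeGradPotential_step {d : ℕ} {ε G v : ℝ} (hε : 0 ≤ ε) (hG : 0 < G) (s g : Vec d)
    (hg : ‖g‖ ≤ G) (hv : G ^ 2 ≤ v) :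
    inner ℝ g (freeGradPrediction ε G s v) + freeGradPotential ε G (s + g) (v + ‖g‖ ^ 2)
      ≤ freeGradPotential ε G s v := by
  obtain ⟨c, hc, hc2⟩ := exists_cos_mul_norm hG g s
  have hv0 : 0 < v := (pow_pos hG 2).trans_le hv
  have hr : (‖s + g‖ / G) ^ 2 = (‖s‖ / G) ^ 2 + 2 * (c * (‖s‖ / G)) + ‖g‖ ^ 2 / G ^ 2 := by
    rw [hc, div_pow, norm_add_sq_real, real_inner_comm]
    ring
  have h := unitPotential_step (v := v / G ^ 2) (x := ‖s‖ / G)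
    ((one_le_div (by positivity)).2 hv) (by positivity) hc2
    ((div_le_one (by positivity)).2 (pow_le_pow_left₀ (norm_nonneg _) hg 2)) (by positivity) hr
  have h' := mul_le_mul_of_nonneg_left h (mul_nonneg hε hG.le)
  rw [freeGradPotential, freeGradPotential, freeGradPrediction, real_inner_smul_right, add_div]
  refine le_trans (add_le_add_right h' _) (le_of_eq ?_)
  have e0 : c * (‖s‖ / G * (2 * (v / G ^ 2) + ‖s‖ / G) / (2 * (v / G ^ 2 + ‖s‖ / G) ^ 2)) =
      inner ℝ g s * (2 * v + G * ‖s‖) / (2 * (v + G * ‖s‖) ^ 2) := by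
    rw [mul_div_assoc, ← mul_assoc c, hc]
    field_simp
  have e1 : (‖s‖ / G) ^ 2 / (2 * (v / G ^ 2 + ‖s‖ / G)) = ‖s‖ ^ 2 / (2 * v + 2 * G * ‖s‖) := by
    field_simp
  have e2 : √(v / G ^ 2) = √v / G := by rw [Real.sqrt_div' _ (sq_nonneg G), Real.sqrt_sq hG.le]
  rw [e0, unitPotential, e1, e2]
  have hsv : √v ≠ 0 := (Real.sqrt_pos.2 hv0).ne'
  field_simp
  ring

/-- A substitute for computing the convex conjugate of the potential. If the bound failed, `x` would
exceed `√(2yl) + 2l` while the potential term stayed below `xW`; the latter forces the exponent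
below `l`, that is `x² < 2l(y + x)`, contradicting the size of `x`. -/
theorem mul_sub_unitPotential_le {x y W ε l : ℝ} (hx : 0 ≤ x) (hy : 0 < y) (hW : 0 ≤ W)
    (hε : 0 < ε) (hl : 0 ≤ l) (h : x * √y * W ≤ ε * Real.exp l) :
    x * W - ε * unitPotential x y ≤ W * (√(2 * y * l) + 2 * l) := by
  by_contra! hcon
  have hpot : 0 ≤ unitPotential x y := by unfold unitPotential; positivity
  have h1 : √(2 * y * l) + 2 * l < x := by
    by_contra! hle
    nlinarith [mul_le_mul_of_nonneg_left hle hW, mul_nonneg hε.le hpot]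
  have h2 : ε * unitPotential x y < x * W := by
    have : 0 ≤ W * (√(2 * y * l) + 2 * l) := by positivity
    linarith
  have hsy : 0 < √y := Real.sqrt_pos.2 hy
  have h3 : Real.exp (x ^ 2 / (2 * (y + x))) < Real.exp l := by
    rw [unitPotential, ← mul_div_assoc, div_lt_iff₀ hsy] at h2
    exact lt_of_mul_lt_mul_left (h2.trans_le (by linarith)) hε.le
  rw [Real.exp_lt_exp, div_lt_iff₀ (by positivity)] at h3
  have h4 := Real.sq_sqrt (show 0 ≤ 2 * y * l by positivity)
  nlinarith [Real.sqrt_nonneg (2 * y * l)]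

/-! ### Surrogate gradients and the regret of one feature -/

theorem surrogateGradients_append_singleton {d : ℕ} (h : ℕ → ℝ) (gs : List (Vec d)) (g : Vec d) :
    surrogateGradients h (gs ++ [g]) = surrogateGradients h gs ++
      if h (gs.length + 1) = 0 then [] else [h (gs.length + 1) • g] := by
  rw [surrogateGradients, surrogateGradients, List.zipIdx_append, List.filterMap_append]
  congr 1
  simp only [List.zipIdx_singleton, Nat.add_comm 1]
  split_ifs with h0 <;> simp [h0]

theorem sum_surrogateGradients {d : ℕ} (h : ℕ → ℝ) (g : ℕ → Vec d) (n : ℕ) :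
    (surrogateGradients h ((List.range n).map g)).sum
      = ∑ i ∈ Finset.range n, h (i + 1) • g i := by
  induction n with
  | zero => simp [surrogateGradients]
  | succ n ih =>
    rw [List.range_succ, List.map_append, List.map_singleton, surrogateGradients_append_singleton,
      List.sum_append, ih, Finset.sum_range_succ]
    simp only [List.length_map, List.length_range]
    split_ifs with h0 <;> simp [h0]

theorem sum_norm_sq_surrogateGradients {d : ℕ} (h : ℕ → ℝ) (g : ℕ → Vec d) (n : ℕ) :
    ((surrogateGradients h ((List.range n).map g)).map fun g => ‖g‖ ^ 2).sum
      = ∑ i ∈ Finset.range n, ‖h (i + 1) • g i‖ ^ 2 := by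
  induction n with
  | zero => simp [surrogateGradients]
  | succ n ih =>
    rw [List.range_succ, List.map_append, List.map_singleton, surrogateGradients_append_singleton,
      List.map_append, List.sum_append, ih, Finset.sum_range_succ]
    simp only [List.length_map, List.length_range]
    split_ifs with h0 <;> simp [h0]

/-- Telescopes the potential from its initial value `εG`, taken at `s = 0`, `v = G²`. Skipped rounds
have `h = 0` and add nothing to `s` or `v`, so the sums may run over all rounds. -/
theorem sum_inner_featureLearner_le {d : ℕ} {ε G : ℝ} (hε : 0 ≤ ε) (hG : 0 < G) {h : ℕ → ℝ}
    (hh : ∀ t, |h t| ≤ 1) {g : ℕ → Vec d} (hg : ∀ i, ‖g i‖ ≤ G) (n : ℕ) :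
    ∑ i ∈ Finset.range n, inner ℝ (g i) (featureLearner ε G h ((List.range i).map g)) +
      freeGradPotential ε G (∑ i ∈ Finset.range n, h (i + 1) • g i)
        (G ^ 2 + ∑ i ∈ Finset.range n, ‖h (i + 1) • g i‖ ^ 2) ≤ ε * G := by
  induction n with
  | zero => simp [freeGradPotential, unitPotential, hG.ne']
  | succ n ih =>
    refine le_trans ?_ ih
    rw [Finset.sum_range_succ, Finset.sum_range_succ, Finset.sum_range_succ, ← add_assoc, add_assoc]
    refine add_le_add_right ?_ _
    have hn : ‖h (n + 1) • g n‖ ≤ G := by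
      rw [norm_smul, Real.norm_eq_abs]
      exact (mul_le_of_le_one_left (norm_nonneg _) (hh _)).trans (hg n)
    refine le_trans (le_of_eq ?_) (freeGradPotential_step hε hG _ _ hn
      (le_add_of_nonneg_right (Finset.sum_nonneg fun i _ => sq_nonneg _)))
    rw [featureLearner, freeGrad, sum_surrogateGradients, sum_norm_sq_surrogateGradients,
      List.length_map, List.length_range, real_inner_smul_right, real_inner_smul_left]

/-- The regret of the FreeGrad copy of a single feature. -/
theorem featureLearner_regret {d : ℕ} {ε G N l : ℝ} (hε : 0 < ε) (hG : 0 < G) {h : ℕ → ℝ}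
    (hh : ∀ t, |h t| ≤ 1) {g : ℕ → Vec d} (hg : ∀ i, ‖g i‖ ≤ G) {n : ℕ} (hN : 1 ≤ N)
    (hsum : ∑ i ∈ Finset.range n, |h (i + 1)| ≤ N) (hl : 0 ≤ l) (w : Vec d)
    (hw : 2 * N ^ 2 * ‖w‖ ≤ ε * Real.exp l) :
    ∑ i ∈ Finset.range n,
      inner ℝ (g i) (featureLearner ε G h ((List.range i).map g) - h (i + 1) • w)
      ≤ ε * G + 4 * G * (1 + l) * (‖w‖ * √N) := by
  have hreg := sum_inner_featureLearner_le hε.le hG hh hg n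
  set s := ∑ i ∈ Finset.range n, h (i + 1) • g i with hs
  set v := G ^ 2 + ∑ i ∈ Finset.range n, ‖h (i + 1) • g i‖ ^ 2 with hv
  have hi : ∀ i, ‖h (i + 1) • g i‖ ≤ |h (i + 1)| * G := fun i => by
    rw [norm_smul, Real.norm_eq_abs]
    exact mul_le_mul_of_nonneg_left (hg i) (abs_nonneg _)
  have hx : ‖s‖ / G ≤ N := by
    rw [div_le_iff₀ hG]
    calc ‖s‖ ≤ ∑ i ∈ Finset.range n, |h (i + 1)| * G :=
          (norm_sum_le _ _).trans (Finset.sum_le_sum fun i _ => hi i)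
      _ ≤ N * G := by rw [← Finset.sum_mul]; gcongr
  have hy1 : 1 ≤ v / G ^ 2 := by
    rw [one_le_div (by positivity)]
    exact le_add_of_nonneg_right (Finset.sum_nonneg fun i _ => sq_nonneg _)
  have hy : v / G ^ 2 ≤ 2 * N := by
    rw [div_le_iff₀ (by positivity)]
    have : ∑ i ∈ Finset.range n, ‖h (i + 1) • g i‖ ^ 2 ≤ N * G ^ 2 := by
      calc _ ≤ ∑ i ∈ Finset.range n, |h (i + 1)| * G ^ 2 := by
            refine Finset.sum_le_sum fun i _ => ?_
            refine (pow_le_pow_left₀ (norm_nonneg _) (hi i) 2).trans ?_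
            rw [mul_pow]
            refine mul_le_mul_of_nonneg_right ?_ (sq_nonneg G)
            rw [sq]
            exact mul_le_of_le_one_left (abs_nonneg _) (hh _)
        _ ≤ N * G ^ 2 := by rw [← Finset.sum_mul]; gcongr
    nlinarith [sq_nonneg G]
  have hsy : √(v / G ^ 2) ≤ 2 * N := by
    rw [Real.sqrt_le_left (by linarith)]
    nlinarith
  have hlin : ∑ i ∈ Finset.range n, inner ℝ (g i) (h (i + 1) • w) = inner ℝ s w := by
    rw [hs, sum_inner]
    exact Finset.sum_congr rfl fun i _ => by rw [real_inner_smul_right, real_inner_smul_left]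
  -- The normalised state satisfies `x ≤ N` and `√y ≤ 2N`, which is where the `2 * N ^ 2` in `hw`
  -- comes from.
  have hmul := mul_sub_unitPotential_le (x := ‖s‖ / G) (y := v / G ^ 2) (W := ‖w‖) (ε := ε) (l := l)
    (by positivity) (by linarith) (norm_nonneg w) hε hl (by
      refine le_trans (mul_le_mul_of_nonneg_right (mul_le_mul hx hsy (Real.sqrt_nonneg _)
        (by linarith)) (norm_nonneg w)) (le_trans (le_of_eq ?_) hw)
      ring)
  have hsq : √(2 * (v / G ^ 2) * l) + 2 * l ≤ 4 * (1 + l) * √N := by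
    have h1 : √(2 * (v / G ^ 2) * l) ≤ 2 * (1 + l) * √N := by
      rw [Real.sqrt_le_left (by positivity), mul_pow, Real.sq_sqrt (by linarith)]
      have : v / G ^ 2 * l ≤ 2 * N * l := mul_le_mul_of_nonneg_right hy hl
      nlinarith [mul_nonneg (sq_nonneg l) (by linarith : (0 : ℝ) ≤ N),
        mul_nonneg hl (by linarith : (0 : ℝ) ≤ N)]
    have h2 : 1 ≤ √N := Real.one_le_sqrt.2 hN
    nlinarith
  simp only [inner_sub_right, Finset.sum_sub_distrib]
  rw [hlin]
  have h1 : -inner ℝ s w ≤ G * (‖s‖ / G * ‖w‖) := by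
    have := (abs_le.1 (abs_real_inner_le_norm s w)).1
    have e : G * (‖s‖ / G * ‖w‖) = ‖s‖ * ‖w‖ := by field_simp
    linarith
  have h2 := mul_le_mul_of_nonneg_left
    (hmul.trans (mul_le_mul_of_nonneg_left hsq (norm_nonneg w))) hG.le
  rw [freeGradPotential] at hreg
  linarith

/-! ### The Haar decomposition of a comparator sequence -/

theorem sum_Icc_one_eq_sum_range {M : Type*} [AddCommMonoid M] (f : ℕ → M) (n : ℕ) :
    ∑ i ∈ Finset.Icc 1 n, f i = ∑ i ∈ Finset.range n, f (i + 1) := by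
  induction n with
  | zero => simp
  | succ n ih => rw [Finset.sum_Icc_succ_top (by omega), ih, Finset.sum_range_succ]

/-- Zero-based form: the halves of the support are consecutive dyadic intervals of length `2 ^ j`,
recognised by the quotient `i / 2 ^ j`. -/
theorem haarFeature_succ (j p i : ℕ) :
    haarFeature (j + 1) (p + 1) (i + 1) =
      if i / 2 ^ j = 2 * p then 1 else if i / 2 ^ j = 2 * p + 1 then -1 else 0 := by
  have hpos : 0 < 2 ^ j := by positivity
  have h1 : i + 1 ∈ Finset.Icc (2 ^ (j + 1) * (p + 1 - 1) + 1)
      (2 ^ (j + 1) * (p + 1 - 1) + 2 ^ (j + 1 - 1)) ↔ i / 2 ^ j = 2 * p := by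
    rw [Finset.mem_Icc, Nat.div_eq_iff hpos, Nat.add_sub_cancel, Nat.add_sub_cancel, pow_succ]
    ring_nf
    omega
  have h2 : i + 1 ∈ Finset.Icc (2 ^ (j + 1) * (p + 1 - 1) + 2 ^ (j + 1 - 1) + 1)
      (2 ^ (j + 1) * (p + 1)) ↔ i / 2 ^ j = 2 * p + 1 := by
    rw [Finset.mem_Icc, Nat.div_eq_iff hpos, Nat.add_sub_cancel, Nat.add_sub_cancel, pow_succ]
    ring_nf
    omega
  simp only [haarFeature, h1, h2]

theorem abs_haarFeature_le (j l t : ℕ) : |haarFeature j l t| ≤ 1 := by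
  unfold haarFeature
  split_ifs <;> simp

theorem sum_abs_haarFeature_le (j p n : ℕ) :
    ∑ i ∈ Finset.range n, |haarFeature (j + 1) (p + 1) (i + 1)| ≤ 2 ^ (j + 1) := by
  have h : ∀ i, |haarFeature (j + 1) (p + 1) (i + 1)| ≤
      if i ∈ Finset.Ico (2 ^ (j + 1) * p) (2 ^ (j + 1) * p + 2 ^ (j + 1)) then 1 else 0 := by
    intro i
    split_ifs with hi
    · exact abs_haarFeature_le _ _ _
    · rw [haarFeature_succ]
      rw [Finset.mem_Ico, pow_succ] at hi
      have hpos : 0 < 2 ^ j := by positivity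
      rw [if_neg, if_neg] <;> [simp; skip; skip] <;>
      · rw [Nat.div_eq_iff hpos]
        ring_nf at hi ⊢
        omega
  calc _ ≤ ∑ i ∈ Finset.range n,
        if i ∈ Finset.Ico (2 ^ (j + 1) * p) (2 ^ (j + 1) * p + 2 ^ (j + 1)) then (1 : ℝ) else 0 :=
        Finset.sum_le_sum fun i _ => h i
    _ ≤ ((Finset.Ico (2 ^ (j + 1) * p) (2 ^ (j + 1) * p + 2 ^ (j + 1))).card : ℝ) := by
        rw [Finset.sum_boole]
        exact_mod_cast Finset.card_le_card fun i hi => (Finset.mem_filter.1 hi).2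
    _ = 2 ^ (j + 1) := by simp

/-! ### Dyadic averages and Haar reconstruction -/

section Dyadic

variable {E : Type*} [AddCommMonoid E]

/-- The sum of `U` over the dyadic interval `[2 ^ j * p, 2 ^ j * (p + 1))`. -/
def dyadicSum (U : ℕ → E) (j p : ℕ) : E := ∑ i ∈ Finset.range (2 ^ j), U (2 ^ j * p + i)

theorem dyadicSum_zero (U : ℕ → E) (p : ℕ) : dyadicSum U 0 p = U p := by simp [dyadicSum]

theorem dyadicSum_succ (U : ℕ → E) (j p : ℕ) :
    dyadicSum U (j + 1) p = dyadicSum U j (2 * p) + dyadicSum U j (2 * p + 1) := by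
  rw [dyadicSum, pow_succ, mul_two, Finset.sum_range_add, dyadicSum, dyadicSum]
  congr 1 <;> refine Finset.sum_congr rfl fun i _ => congrArg U ?_ <;> ring

theorem sum_dyadicSum (U : ℕ → E) (j k : ℕ) :
    ∑ p ∈ Finset.range k, dyadicSum U j p = ∑ i ∈ Finset.range (2 ^ j * k), U i := by
  induction k with
  | zero => simp
  | succ k ih => rw [Finset.sum_range_succ, ih, Nat.mul_succ, Finset.sum_range_add, dyadicSum]

end Dyadic

variable {d : ℕ}

theorem norm_dyadicSum_le (U : ℕ → Vec d) (j p : ℕ) :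
    ‖dyadicSum U j p‖ ≤ dyadicSum (fun i => ‖U i‖) j p := norm_sum_le _ _

theorem sq_dyadicSum_le (f : ℕ → ℝ) (j p : ℕ) :
    dyadicSum f j p ^ 2 ≤ 2 ^ j * dyadicSum (fun i => f i ^ 2) j p := by
  have := sq_sum_le_card_mul_sum_sq (s := Finset.range (2 ^ j)) (f := fun i => f (2 ^ j * p + i))
  simpa [dyadicSum] using this

theorem dyadicSum_le {f : ℕ → ℝ} {c : ℝ} (hf : ∀ i, f i ≤ c) (j p : ℕ) :
    dyadicSum f j p ≤ 2 ^ j * c := by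
  have := Finset.sum_le_card_nsmul (Finset.range (2 ^ j)) (fun i => f (2 ^ j * p + i)) c
    fun i _ => hf _
  simpa [dyadicSum] using this

/-- The average of `U` over the dyadic interval `[2 ^ j * p, 2 ^ j * (p + 1))`. -/
def dyadicAverage (U : ℕ → Vec d) (j p : ℕ) : Vec d := ((2 : ℝ) ^ j)⁻¹ • dyadicSum U j p

/-- The Haar coefficient of `U` at scale `j + 1` and the location with index `p` from zero. -/
def haarCoeff (U : ℕ → Vec d) (j p : ℕ) : Vec d :=
  ((2 : ℝ) ^ (j + 1))⁻¹ • (dyadicSum U j (2 * p) - dyadicSum U j (2 * p + 1))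

theorem dyadicAverage_eq_add_haarCoeff (U : ℕ → Vec d) (j p : ℕ) :
    dyadicAverage U j (2 * p) = dyadicAverage U (j + 1) p + haarCoeff U j p := by
  rw [dyadicAverage, dyadicAverage, haarCoeff, dyadicSum_succ, ← smul_add, add_add_sub_cancel,
    ← two_smul ℝ, smul_smul, pow_succ]
  congr 1
  field_simp

theorem dyadicAverage_eq_sub_haarCoeff (U : ℕ → Vec d) (j p : ℕ) :
    dyadicAverage U j (2 * p + 1) = dyadicAverage U (j + 1) p - haarCoeff U j p := by
  rw [dyadicAverage, dyadicAverage, haarCoeff, dyadicSum_succ, ← smul_sub, add_sub_sub_cancel,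
    ← two_smul ℝ, smul_smul, pow_succ]
  congr 1
  field_simp

theorem dyadicAverage_step (U : ℕ → Vec d) {m j i : ℕ} (hj : j < m) (hi : i < 2 ^ m) :
    dyadicAverage U j (i / 2 ^ j) = dyadicAverage U (j + 1) (i / 2 ^ (j + 1)) +
      ∑ p ∈ Finset.range (2 ^ (m - (j + 1))),
        haarFeature (j + 1) (p + 1) (i + 1) • haarCoeff U j p := by
  have hdiv : i / 2 ^ (j + 1) = i / 2 ^ j / 2 := by rw [pow_succ, Nat.div_div_eq_div_mul]
  have hmem : i / 2 ^ (j + 1) ∈ Finset.range (2 ^ (m - (j + 1))) := by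
    rw [Finset.mem_range, Nat.div_lt_iff_lt_mul (by positivity), ← pow_add]
    rwa [Nat.sub_add_cancel hj]
  rw [Finset.sum_eq_single_of_mem _ hmem, haarFeature_succ]
  · rcases Nat.even_or_odd' (i / 2 ^ j) with ⟨q, hq | hq⟩
    · have e : i / 2 ^ (j + 1) = q := by omega
      rw [e, hq, dyadicAverage_eq_add_haarCoeff]
      simp
    · have e : i / 2 ^ (j + 1) = q := by omega
      rw [e, hq, dyadicAverage_eq_sub_haarCoeff]
      simp [sub_eq_add_neg]
  · intro p _ hp
    rw [haarFeature_succ, if_neg (by omega), if_neg (by omega), zero_smul]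

/-- The averages over the dyadic intervals containing `i` telescope over the scales, from `U i`
itself to the average over the whole block; each increment is plus or minus one Haar coefficient. -/
theorem haar_reconstruction (U : ℕ → Vec d) {m i : ℕ} (hi : i < 2 ^ m) :
    U i = dyadicAverage U m 0 + ∑ j ∈ Finset.range m, ∑ p ∈ Finset.range (2 ^ (m - (j + 1))),
      haarFeature (j + 1) (p + 1) (i + 1) • haarCoeff U j p := by
  have h : ∀ k ≤ m, U i = dyadicAverage U k (i / 2 ^ k) + ∑ j ∈ Finset.range k,
      ∑ p ∈ Finset.range (2 ^ (m - (j + 1))),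
        haarFeature (j + 1) (p + 1) (i + 1) • haarCoeff U j p := by
    intro k hk
    induction k with
    | zero => simp [dyadicAverage, dyadicSum_zero]
    | succ k ih =>
      rw [ih (by omega), dyadicAverage_step U (by omega) hi, Finset.sum_range_succ]
      abel
  have := h m le_rfl
  rwa [Nat.div_eq_of_lt hi] at this

/-! ### Size and sparsity of the Haar coefficients -/

theorem norm_dyadicAverage_le {U : ℕ → Vec d} {c : ℝ} (hU : ∀ i, ‖U i‖ ≤ c) (j p : ℕ) :
    ‖dyadicAverage U j p‖ ≤ c := by
  rw [dyadicAverage, norm_smul, Real.norm_of_nonneg (by positivity), inv_mul_le_iff₀ (by positivity)]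
  exact (norm_dyadicSum_le U j p).trans (dyadicSum_le hU j p)

theorem le_sqrt_of_mul_le {N a s Q : ℝ} (hN : 0 < N) (ha : 0 ≤ a) (h : N * a ≤ s)
    (hs : s ^ 2 ≤ N * Q) : a * √N ≤ √Q := by
  apply Real.le_sqrt_of_sq_le
  rw [mul_pow, Real.sq_sqrt hN.le]
  have h1 : (N * a) ^ 2 ≤ N * Q := (pow_le_pow_left₀ (by positivity) h 2).trans hs
  refine le_of_mul_le_mul_left ?_ hN
  linarith

theorem norm_dyadicAverage_mul_sqrt_le (U : ℕ → Vec d) (j p : ℕ) :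
    ‖dyadicAverage U j p‖ * √(2 ^ j) ≤ √(dyadicSum (fun i => ‖U i‖ ^ 2) j p) := by
  refine le_sqrt_of_mul_le (by positivity) (norm_nonneg _) ?_ (sq_dyadicSum_le (fun i => ‖U i‖) j p)
  rw [dyadicAverage, norm_smul, Real.norm_of_nonneg (by positivity),
    mul_inv_cancel_left₀ (by positivity)]
  exact norm_dyadicSum_le U j p

theorem two_pow_mul_norm_haarCoeff_le (U : ℕ → Vec d) (j p : ℕ) :
    2 ^ (j + 1) * ‖haarCoeff U j p‖ ≤ dyadicSum (fun i => ‖U i‖) (j + 1) p := by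
  rw [haarCoeff, norm_smul, Real.norm_of_nonneg (by positivity),
    mul_inv_cancel_left₀ (by positivity), dyadicSum_succ]
  exact (norm_sub_le _ _).trans
    (add_le_add (norm_dyadicSum_le U j _) (norm_dyadicSum_le U j _))

theorem norm_haarCoeff_le {U : ℕ → Vec d} {c : ℝ} (hU : ∀ i, ‖U i‖ ≤ c) (j p : ℕ) :
    ‖haarCoeff U j p‖ ≤ c :=
  le_of_mul_le_mul_left ((two_pow_mul_norm_haarCoeff_le U j p).trans (dyadicSum_le hU _ _))
    (by positivity)

theorem norm_haarCoeff_mul_sqrt_le (U : ℕ → Vec d) (j p : ℕ) :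
    ‖haarCoeff U j p‖ * √(2 ^ (j + 1)) ≤ √(dyadicSum (fun i => ‖U i‖ ^ 2) (j + 1) p) :=
  le_sqrt_of_mul_le (by positivity) (norm_nonneg _) (two_pow_mul_norm_haarCoeff_le U j p)
    (sq_dyadicSum_le (fun i => ‖U i‖) (j + 1) p)

/-- The source of sparsity: a sequence constant on the interval has equal sums on both halves. -/
theorem haarCoeff_eq_zero {U : ℕ → Vec d} {j p : ℕ}
    (h : ∀ i, i / 2 ^ (j + 1) = p → U (i + 1) = U i) : haarCoeff U j p = 0 := by
  have hc : ∀ i < 2 ^ (j + 1), U (2 ^ (j + 1) * p + i) = U (2 ^ (j + 1) * p) := by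
    intro i hi
    induction i with
    | zero => rfl
    | succ i ih =>
      rw [← ih (by omega), ← add_assoc]
      apply h
      rw [Nat.mul_add_div (by positivity), Nat.div_eq_of_lt (by omega), add_zero]
  have h1 : ∀ b < 2, dyadicSum U j (2 * p + b) = (2 ^ j) • U (2 ^ (j + 1) * p) := by
    intro b hb
    have : ∀ i ∈ Finset.range (2 ^ j), U (2 ^ j * (2 * p + b) + i) = U (2 ^ (j + 1) * p) := by
      intro i hi
      rw [← hc (2 ^ j * b + i)]
      · congr 1
        ring
      · have := Finset.mem_range.1 hi
        rw [pow_succ]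
        nlinarith [Nat.mul_le_mul_left (2 ^ j) (Nat.lt_succ_iff.1 hb)]
    rw [dyadicSum, Finset.sum_congr rfl this]
    simp
  rw [haarCoeff, h1 1 (by omega), show 2 * p = 2 * p + 0 from rfl, h1 0 (by omega)]
  simp

/-- At a fixed scale a switch `i` is charged only to the interval `i / 2 ^ (j + 1)`, so at most
`S.card` coefficients are nonzero. Cauchy–Schwarz over these, with the energies of disjoint
intervals, gives the bound. -/
theorem sum_norm_haarCoeff_mul_sqrt_le {U : ℕ → Vec d} {S : Finset ℕ}
    (hS : ∀ i, U (i + 1) ≠ U i → i ∈ S) {m j : ℕ} (hj : j < m) :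
    ∑ p ∈ Finset.range (2 ^ (m - (j + 1))), ‖haarCoeff U j p‖ * √(2 ^ (j + 1))
      ≤ √(S.card * ∑ i ∈ Finset.range (2 ^ m), ‖U i‖ ^ 2) := by
  classical
  set R := Finset.range (2 ^ (m - (j + 1)))
  set Z := R.filter fun p => haarCoeff U j p ≠ 0 with hZ
  have hcard : Z.card ≤ S.card := by
    refine le_trans (Finset.card_le_card ?_) (Finset.card_image_le (f := fun i => i / 2 ^ (j + 1)))
    intro p hp
    by_contra hcon
    refine (Finset.mem_filter.1 hp).2 (haarCoeff_eq_zero fun i hi => ?_)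
    by_contra hne
    exact hcon (Finset.mem_image.2 ⟨i, hS i hne, hi⟩)
  have hQ : ∀ p, 0 ≤ dyadicSum (fun i => ‖U i‖ ^ 2) (j + 1) p := fun p =>
    Finset.sum_nonneg fun i _ => sq_nonneg _
  apply Real.le_sqrt_of_sq_le
  calc (∑ p ∈ R, ‖haarCoeff U j p‖ * √(2 ^ (j + 1))) ^ 2
      = (∑ p ∈ Z, ‖haarCoeff U j p‖ * √(2 ^ (j + 1))) ^ 2 := by
        rw [hZ, Finset.sum_filter_of_ne]
        intro p _ hp h0
        simp [h0] at hp
    _ ≤ Z.card * ∑ p ∈ Z, (‖haarCoeff U j p‖ * √(2 ^ (j + 1))) ^ 2 := sq_sum_le_card_mul_sum_sq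
    _ ≤ S.card * ∑ p ∈ R, dyadicSum (fun i => ‖U i‖ ^ 2) (j + 1) p := by
        refine mul_le_mul (by exact_mod_cast hcard) ?_
          (Finset.sum_nonneg fun _ _ => sq_nonneg _) (Nat.cast_nonneg _)
        refine le_trans (Finset.sum_le_sum fun p _ => ?_)
          (Finset.sum_le_sum_of_subset_of_nonneg (Finset.filter_subset _ _) fun p _ _ => hQ p)
        have := pow_le_pow_left₀ (by positivity) (norm_haarCoeff_mul_sqrt_le U j p) 2
        rwa [Real.sq_sqrt (hQ p)] at this
    _ = S.card * ∑ i ∈ Finset.range (2 ^ m), ‖U i‖ ^ 2 := by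
        rw [sum_dyadicSum, ← pow_add, Nat.add_sub_cancel' hj]

/-! ### The regret of Haar OLR -/

theorem haarOLR_apply (m : ℕ) (ε G : ℝ) (gs : List (Vec d)) :
    haarOLR m ε G gs = featureLearner (ε / 2 ^ m) G (fun _ => 1) gs
      + ∑ j ∈ Finset.range m, ∑ p ∈ Finset.range (2 ^ (m - (j + 1))),
        featureLearner (ε / 2 ^ m) G (haarFeature (j + 1) (p + 1)) gs := by
  rw [haarOLR, sum_Icc_one_eq_sum_range]
  simp only [sum_Icc_one_eq_sum_range]

theorem one_add_sum_two_pow (m : ℕ) :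
    1 + ∑ j ∈ Finset.range m, (2 : ℝ) ^ (m - (j + 1)) = 2 ^ m := by
  have h := Finset.sum_range_reflect (fun j => (2 : ℝ) ^ j) m
  have e : ∀ j, m - 1 - j = m - (j + 1) := fun j => by omega
  simp only [e] at h
  rw [h, geom_sum_eq (by norm_num)]
  ring

theorem haarOLR_regret {ε G l M : ℝ} (hε : 0 < ε) (hG : 0 < G) (hl : 0 ≤ l) {g : ℕ → Vec d}
    (hg : ∀ i, ‖g i‖ ≤ G) {m n : ℕ} (hn : n ≤ 2 ^ m) (c : Vec d) {U : ℕ → Vec d} {S : Finset ℕ}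
    (hS : ∀ i, U (i + 1) ≠ U i → i ∈ S) (hM : ∀ i, ‖c‖ + ‖U i‖ ≤ M)
    (hl' : 2 * (2 ^ m) ^ 3 * M ≤ ε * Real.exp l) :
    ∑ i ∈ Finset.range n,
      inner ℝ (g i) (haarOLR m ε G ((List.range i).map g) - (c + U i)) ≤
      ε * G + 4 * G * (1 + l) * (‖c‖ * √(2 ^ m) + √(∑ i ∈ Finset.range (2 ^ m), ‖U i‖ ^ 2)
        + m * √(S.card * ∑ i ∈ Finset.range (2 ^ m), ‖U i‖ ^ 2)) := by
  set Q := ∑ i ∈ Finset.range (2 ^ m), ‖U i‖ ^ 2 with hQ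
  have hpow : (0 : ℝ) < 2 ^ m := by positivity
  have hM' : ∀ i, ‖U i‖ ≤ M - ‖c‖ := fun i => by linarith [hM i]
  -- The cube of `2 ^ m` in `hl'` is `N²` from the single-feature condition times the `2 ^ m`
  -- dividing `ε`.
  have hlog : ∀ (N : ℝ) (w : Vec d), 0 ≤ N → N ≤ 2 ^ m → ‖w‖ ≤ M →
      2 * N ^ 2 * ‖w‖ ≤ ε / 2 ^ m * Real.exp l := by
    intro N w hN0 hN hw
    have : 2 * N ^ 2 * ‖w‖ ≤ 2 * (2 ^ m) ^ 2 * M := by gcongr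
    rw [div_mul_eq_mul_div, le_div_iff₀ hpow]
    nlinarith
  have hconst := featureLearner_regret (ε := ε / 2 ^ m) (N := 2 ^ m) (l := l) (h := fun _ => 1)
    (n := n) (by positivity) hG (by simp) hg (one_le_pow₀ (by norm_num))
    (by simpa using (by exact_mod_cast hn : (n : ℝ) ≤ 2 ^ m)) hl (c + dyadicAverage U m 0)
    (hlog _ _ hpow.le le_rfl ((norm_add_le _ _).trans
      (by linarith [norm_dyadicAverage_le hM' m 0])))
  have hfeat : ∀ j ∈ Finset.range m, ∀ p ∈ Finset.range (2 ^ (m - (j + 1))),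
      ∑ i ∈ Finset.range n, inner ℝ (g i)
        (featureLearner (ε / 2 ^ m) G (haarFeature (j + 1) (p + 1)) ((List.range i).map g)
          - haarFeature (j + 1) (p + 1) (i + 1) • haarCoeff U j p) ≤
      ε / 2 ^ m * G + 4 * G * (1 + l) * (‖haarCoeff U j p‖ * √(2 ^ (j + 1))) := by
    intro j hj p _
    have hjm : j + 1 ≤ m := Finset.mem_range.1 hj
    exact featureLearner_regret (by positivity) hG (abs_haarFeature_le _ _) hg
      (one_le_pow₀ (by norm_num)) (sum_abs_haarFeature_le j p n) hl _
      (hlog _ _ (by positivity) (pow_le_pow_right₀ (by norm_num) hjm)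
        (by linarith [norm_haarCoeff_le hM' j p, norm_nonneg c]))
  have hdecomp : ∀ i ∈ Finset.range n,
      inner ℝ (g i) (haarOLR m ε G ((List.range i).map g) - (c + U i)) =
      inner ℝ (g i) (featureLearner (ε / 2 ^ m) G (fun _ => 1) ((List.range i).map g)
        - (1 : ℝ) • (c + dyadicAverage U m 0)) +
      ∑ j ∈ Finset.range m, ∑ p ∈ Finset.range (2 ^ (m - (j + 1))), inner ℝ (g i)
        (featureLearner (ε / 2 ^ m) G (haarFeature (j + 1) (p + 1)) ((List.range i).map g)
          - haarFeature (j + 1) (p + 1) (i + 1) • haarCoeff U j p) := by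
    intro i hi
    rw [haarOLR_apply]
    nth_rewrite 1 [haar_reconstruction U ((Finset.mem_range.1 hi).trans_le hn)]
    simp only [← inner_sum, ← inner_add_right, Finset.sum_sub_distrib, one_smul]
    congr 1
    abel
  rw [Finset.sum_congr rfl hdecomp, Finset.sum_add_distrib, Finset.sum_comm]
  have hswap : ∀ j ∈ Finset.range m, ∑ i ∈ Finset.range n,
      ∑ p ∈ Finset.range (2 ^ (m - (j + 1))), inner ℝ (g i)
        (featureLearner (ε / 2 ^ m) G (haarFeature (j + 1) (p + 1)) ((List.range i).map g)
          - haarFeature (j + 1) (p + 1) (i + 1) • haarCoeff U j p) ≤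
      2 ^ (m - (j + 1)) * (ε / 2 ^ m * G) + 4 * G * (1 + l) * √(S.card * Q) := by
    intro j hj
    rw [Finset.sum_comm]
    refine (Finset.sum_le_sum (hfeat j hj)).trans ?_
    rw [Finset.sum_add_distrib, Finset.sum_const, ← Finset.mul_sum]
    refine add_le_add (le_of_eq (by simp)) (mul_le_mul_of_nonneg_left ?_
      (by positivity : 0 ≤ 4 * G * (1 + l)))
    exact sum_norm_haarCoeff_mul_sqrt_le hS (Finset.mem_range.1 hj)
  refine (add_le_add hconst (Finset.sum_le_sum hswap)).trans ?_
  rw [Finset.sum_add_distrib, ← Finset.sum_mul, Finset.sum_const, Finset.card_range, nsmul_eq_mul]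
  have hw0 : ‖c + dyadicAverage U m 0‖ * √(2 ^ m) ≤ ‖c‖ * √(2 ^ m) + √Q := by
    have h1 := norm_dyadicAverage_mul_sqrt_le U m 0
    have h2 : dyadicSum (fun i => ‖U i‖ ^ 2) m 0 = Q := by simp [dyadicSum, hQ]
    rw [h2] at h1
    have := mul_le_mul_of_nonneg_right (norm_add_le c (dyadicAverage U m 0))
      (Real.sqrt_nonneg (2 ^ m))
    linarith
  have hcount : ε / 2 ^ m * G + (∑ j ∈ Finset.range m, (2 : ℝ) ^ (m - (j + 1))) * (ε / 2 ^ m * G)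
      = ε * G := by
    rw [← one_add_mul, one_add_sum_two_pow]
    field_simp
  have := mul_le_mul_of_nonneg_left hw0 (by positivity : 0 ≤ 4 * G * (1 + l))
  linarith

/-! ### Reduction of the game to linear losses -/

/-- Testing the subgradient inequality at `x + g` gives `‖g‖² ≤ G‖g‖`. -/
theorem Environment.norm_grad_le {G : ℝ≥0} (env : Environment d G) (past : List (Vec d))
    (x : Vec d) : ‖env.grad past x‖ ≤ G := by
  set g := env.grad past x with hg
  have h1 := env.subgradient past x (x + g)
  rw [add_sub_cancel_left, ← hg, real_inner_self_eq_norm_sq] at h1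
  have h2 := (env.lipschitz past x).dist_le_mul (x + g) x
  rw [Real.dist_eq, dist_eq_norm, add_sub_cancel_left] at h2
  have h3 := (le_abs_self _).trans h2
  by_contra! hlt
  nlinarith [G.coe_nonneg]

/-- The gradient revealed in round `i + 1`. -/
def playGradient {G : ℝ≥0} (A : OnlineAlgorithm d) (env : Environment d G) (i : ℕ) : Vec d :=
  env.grad (play A env i).1 (A (play A env i).2)

theorem play_snd {G : ℝ≥0} (A : OnlineAlgorithm d) (env : Environment d G) (n : ℕ) :
    (play A env n).2 = (List.range n).map (playGradient A env) := by
  induction n with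
  | zero => rfl
  | succ n ih =>
    rw [List.range_succ, List.map_append, ← ih]
    rfl

theorem sum_roundLoss_sub_le {G : ℝ≥0} (A : OnlineAlgorithm d) (env : Environment d G) (T : ℕ)
    (u : ℕ → Vec d) :
    ∑ t ∈ Finset.Icc 1 T, roundLoss A env t (prediction A env t)
      - ∑ t ∈ Finset.Icc 1 T, roundLoss A env t (u t) ≤
    ∑ i ∈ Finset.range T, inner ℝ (playGradient A env i)
      (A ((List.range i).map (playGradient A env)) - u (i + 1)) := by
  rw [← Finset.sum_sub_distrib, sum_Icc_one_eq_sum_range]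
  refine Finset.sum_le_sum fun i _ => ?_
  rw [← play_snd]
  have h := env.subgradient (play A env i).1 (A (play A env i).2) (u (i + 1))
  rw [← neg_sub, inner_neg_right] at h
  simp only [roundLoss, prediction, Nat.add_sub_cancel, playGradient]
  linarith

/-! ### Statistics of the comparator sequence -/

theorem comparatorAverage_eq_of_const {T : ℕ} (hT : 1 ≤ T) {u : ℕ → Vec d} {w : Vec d}
    (h : ∀ t ∈ Finset.Icc 1 T, u t = w) : comparatorAverage T u = w := by
  have hT' : (T : ℝ) ≠ 0 := by positivity
  rw [comparatorAverage, Finset.sum_congr rfl h]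
  simp [← Nat.cast_smul_eq_nsmul ℝ, smul_smul, hT']

theorem norm_le_maxRange {T t : ℕ} (ht : t ∈ Finset.Icc 1 T) (u : ℕ → Vec d) :
    ‖u t‖ ≤ maxRange T u := by
  exact_mod_cast Finset.le_sup (f := fun t => ‖u t‖₊) ht

theorem norm_comparatorAverage_le {T : ℕ} (hT : 1 ≤ T) (u : ℕ → Vec d) :
    ‖comparatorAverage T u‖ ≤ maxRange T u := by
  have hT' : (0 : ℝ) < T := by positivity
  rw [comparatorAverage, norm_smul, norm_inv, Real.norm_of_nonneg hT'.le, inv_mul_le_iff₀ hT']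
  refine (norm_sum_le _ _).trans ((Finset.sum_le_sum fun t ht => norm_le_maxRange ht u).trans ?_)
  simp

theorem eq_of_numSwitches_eq_zero {T : ℕ} {u : ℕ → Vec d} (hK : numSwitches T u = 0) :
    ∀ i < T, u (i + 1) = u 1 := by
  classical
  rw [numSwitches, Finset.sum_eq_zero_iff] at hK
  intro i hi
  induction i with
  | zero => rfl
  | succ i ih =>
    rw [← ih (by omega)]
    simpa using hK (i + 1) (Finset.mem_Icc.2 (by omega))

/-- The deviation of the comparator of round `i + 1` from the average, extended by zero. -/
def deviation (T : ℕ) (u : ℕ → Vec d) (i : ℕ) : Vec d :=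
  if i < T then u (i + 1) - comparatorAverage T u else 0

theorem deviation_eq_zero_of_numSwitches_eq_zero {T : ℕ} (hT : 1 ≤ T) {u : ℕ → Vec d}
    (hK : numSwitches T u = 0) (i : ℕ) : deviation T u i = 0 := by
  have h := eq_of_numSwitches_eq_zero hK
  have hc : comparatorAverage T u = u 1 := comparatorAverage_eq_of_const hT fun t ht => by
    obtain ⟨h1, h2⟩ := Finset.mem_Icc.1 ht
    have := h (t - 1) (by omega)
    rwa [Nat.sub_add_cancel h1] at this
  unfold deviation
  split_ifs with hi
  · rw [h i hi, hc, sub_self]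
  · rfl

theorem sum_norm_sq_deviation (T : ℕ) (u : ℕ → Vec d) :
    ∑ i ∈ Finset.range T, ‖deviation T u i‖ ^ 2 = secondOrderVariability T u := by
  rw [secondOrderVariability, sum_Icc_one_eq_sum_range]
  exact Finset.sum_congr rfl fun i hi => by rw [deviation, if_pos (Finset.mem_range.1 hi)]

theorem sum_norm_sq_deviation_shift_le (T : ℕ) (u : ℕ → Vec d) (o n : ℕ) :
    ∑ i ∈ Finset.range n, ‖deviation T u (o + i)‖ ^ 2 ≤ secondOrderVariability T u := by
  have h1 := Finset.sum_range_add (fun i => ‖deviation T u i‖ ^ 2) o n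
  have h2 := Finset.sum_range_add (fun i => ‖deviation T u i‖ ^ 2) T (o + n)
  have h3 : ∀ i ∈ Finset.range (o + n), ‖deviation T u (T + i)‖ ^ 2 = 0 := fun i _ => by
    simp [deviation]
  rw [Finset.sum_eq_zero h3, add_zero, sum_norm_sq_deviation] at h2
  have h4 : ∑ i ∈ Finset.range (o + n), ‖deviation T u i‖ ^ 2
      ≤ ∑ i ∈ Finset.range (T + (o + n)), ‖deviation T u i‖ ^ 2 :=
    Finset.sum_le_sum_of_subset_of_nonneg (Finset.range_mono (by omega)) fun i _ _ => sq_nonneg _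
  have h5 : 0 ≤ ∑ i ∈ Finset.range o, ‖deviation T u i‖ ^ 2 :=
    Finset.sum_nonneg fun i _ => sq_nonneg _
  linarith

theorem norm_comparatorAverage_add_deviation_le {T : ℕ} (hT : 1 ≤ T) (u : ℕ → Vec d) (i : ℕ) :
    ‖comparatorAverage T u‖ + ‖deviation T u i‖ ≤ 3 * maxRange T u := by
  have h1 := norm_comparatorAverage_le hT u
  unfold deviation
  split_ifs with hi
  · have h2 := norm_sub_le (u (i + 1)) (comparatorAverage T u)
    have h3 := norm_le_maxRange (T := T) (Finset.mem_Icc.2 (by omega : 1 ≤ i + 1 ∧ i + 1 ≤ T)) u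
    linarith
  · rw [norm_zero]
    linarith [(maxRange T u).coe_nonneg]

/-- Extension by zero may create one further switch, at the end of the horizon. For `K ≥ 1` it is
absorbed in `K + 1 ≤ 2K`; for `K = 0` the deviation vanishes identically, so no switch arises. -/
theorem exists_switches_deviation {T : ℕ} (hT : 1 ≤ T) (u : ℕ → Vec d) :
    ∃ S : Finset ℕ, S.card ≤ 2 * numSwitches T u ∧
      ∀ i, deviation T u (i + 1) ≠ deviation T u i → i ∈ S := by
  classical
  rcases Nat.eq_zero_or_pos (numSwitches T u) with hK | hK
  · refine ⟨∅, by simp, fun i hi => absurd ?_ hi⟩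
    simp only [deviation_eq_zero_of_numSwitches_eq_zero hT hK]
  · refine ⟨insert (T - 1) ((Finset.range (T - 1)).filter fun i => u (i + 1 + 1) ≠ u (i + 1)),
      ?_, fun i hi => ?_⟩
    · refine (Finset.card_insert_le _ _).trans ?_
      have : numSwitches T u =
          ((Finset.range (T - 1)).filter fun i => u (i + 1 + 1) ≠ u (i + 1)).card := by
        rw [numSwitches, sum_Icc_one_eq_sum_range, Finset.card_filter]
      omega
    · rw [Finset.mem_insert, Finset.mem_filter, Finset.mem_range]
      by_contra! hcon
      refine hi ?_
      rcases lt_or_ge i T with h | h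
      · simp [deviation, h, show i + 1 < T by omega, hcon.2 (by omega)]
      · simp [deviation, show ¬ i < T by omega, show ¬ i + 1 < T by omega]

/-! ### The regret of anytime Haar OLR -/

theorem anytimeHaarOLR_apply (G : ℝ) (g : ℕ → Vec d) {m i : ℕ} (hm : 1 ≤ m) (hi : i < 2 ^ m) :
    anytimeHaarOLR G ((List.range (2 ^ m - 2 + i)).map g) =
      haarOLR m 1 G ((List.range i).map fun k => g (2 ^ m - 2 + k)) := by
  have h2 : 2 ≤ 2 ^ m := by simpa using Nat.pow_le_pow_right (n := 2) (by norm_num) hm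
  have hlog : Nat.log 2 (2 ^ m - 2 + i + 2) = m := by
    rw [Nat.log_eq_iff (by omega), pow_succ]
    omega
  rw [anytimeHaarOLR, List.length_map, List.length_range]
  simp only [hlog]
  rw [List.range_add, List.map_append, List.drop_left' (by simp), List.map_map]
  rfl

theorem anytimeHaarOLR_block_regret {G : ℝ} (hG : 0 < G) {g : ℕ → Vec d} (hg : ∀ i, ‖g i‖ ≤ G)
    {T : ℕ} (hT : 1 ≤ T) (u : ℕ → Vec d) {m n : ℕ} (hm : 1 ≤ m) (hmT : 2 ^ m ≤ T + 1)
    (hn : n ≤ 2 ^ m) (hnT : 2 ^ m - 2 + n ≤ T) {P : ℝ}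
    (hP : P = 1 + Real.log T + Real.log (1 + maxRange T u)) (hmP : (m : ℝ) ≤ 2 * P) :
    ∑ i ∈ Finset.range n, inner ℝ (g (2 ^ m - 2 + i))
      (anytimeHaarOLR G ((List.range (2 ^ m - 2 + i)).map g) - u (2 ^ m - 2 + i + 1)) ≤
    G + 168 * G * P ^ 2 * (‖comparatorAverage T u‖ * √(T : ℝ)
      + √((numSwitches T u : ℝ) * secondOrderVariability T u)) := by
  classical
  set M : ℝ := ((maxRange T u : ℝ≥0) : ℝ) with hM
  set o := 2 ^ m - 2 with ho
  set E := secondOrderVariability T u with hE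
  set Q := ∑ i ∈ Finset.range (2 ^ m), ‖deviation T u (o + i)‖ ^ 2 with hQ
  have hM0 : 0 ≤ M := (maxRange T u).coe_nonneg
  have hT1 : (1 : ℝ) ≤ T := by exact_mod_cast hT
  have hP1 : 1 ≤ P := by
    linarith [Real.log_nonneg hT1, Real.log_nonneg (by linarith : 1 ≤ 1 + M)]
  have h2m : (2 : ℝ) ^ m ≤ 2 * T := by
    have : (2 : ℝ) ^ m ≤ T + 1 := by exact_mod_cast hmT
    linarith
  -- The choice `l = 6P` works because `exp P ≥ 2T(1 + M)`, whose sixth power dominates the left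
  -- side. The factor `3M` bounds `‖ū‖` by `M` and a deviation by `2M`.
  have hexp : 2 * ((2 : ℝ) ^ m) ^ 3 * (3 * M) ≤ 1 * Real.exp (6 * P) := by
    have e1 : Real.exp P = Real.exp 1 * T * (1 + M) := by
      rw [hP, Real.exp_add, Real.exp_add, Real.exp_log (by linarith), Real.exp_log (by linarith)]
    have e2 : 2 ≤ Real.exp 1 := by linarith [Real.add_one_le_exp 1]
    have e3 : 2 * T * (1 + M) ≤ Real.exp P := by rw [e1]; gcongr
    have e4 : Real.exp (6 * P) = Real.exp P ^ 6 := by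
      rw [← Real.exp_nat_mul]
      norm_num
    calc 2 * ((2 : ℝ) ^ m) ^ 3 * (3 * M) ≤ 2 * (2 * T) ^ 3 * (3 * (1 + M)) := by
          gcongr
          linarith
      _ = 48 * (T ^ 3 * (1 + M)) := by ring
      _ ≤ 64 * (T ^ 6 * (1 + M) ^ 6) := by
          gcongr
          · norm_num
          · norm_num
          · exact le_self_pow₀ (by linarith) (by norm_num)
      _ = (2 * T * (1 + M)) ^ 6 := by ring
      _ ≤ 1 * Real.exp (6 * P) := by rw [e4, one_mul]; gcongr
  obtain ⟨S, hScard, hS⟩ := exists_switches_deviation hT u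
  have hreg := haarOLR_regret (ε := 1) (l := 6 * P) (M := 3 * M) (g := fun k => g (o + k))
    (n := n) (m := m) (U := fun i => deviation T u (o + i)) (S := S.image fun i => i - o)
    one_pos hG (by linarith) (fun i => hg _) hn (comparatorAverage T u)
    (fun i hi => Finset.mem_image.2 ⟨o + i, hS _ hi, by simp⟩)
    (fun i => norm_comparatorAverage_add_deviation_le hT u _) hexp
  have hcongr : ∀ i ∈ Finset.range n, inner ℝ (g (o + i))
      (anytimeHaarOLR G ((List.range (o + i)).map g) - u (o + i + 1)) =
      inner ℝ (g (o + i)) (haarOLR m 1 G ((List.range i).map fun k => g (o + k))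
        - (comparatorAverage T u + deviation T u (o + i))) := by
    intro i hi
    have hi' := Finset.mem_range.1 hi
    rw [anytimeHaarOLR_apply G g hm (by omega), deviation, if_pos (by omega), add_sub_cancel]
  rw [Finset.sum_congr rfl hcongr]
  refine hreg.trans ?_
  rw [← hQ, one_mul]
  set X := ‖comparatorAverage T u‖ * √(T : ℝ) with hX
  set K : ℝ := ((numSwitches T u : ℕ) : ℝ) with hK
  set Y := √(K * E) with hY
  have hX0 : 0 ≤ X := by positivity
  have hY0 : 0 ≤ Y := Real.sqrt_nonneg _
  have hQE : Q ≤ E := sum_norm_sq_deviation_shift_le T u o _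
  have hE0 : 0 ≤ E := Finset.sum_nonneg fun i _ => sq_nonneg _
  have hQ0 : 0 ≤ Q := Finset.sum_nonneg fun i _ => sq_nonneg _
  have b1 : ‖comparatorAverage T u‖ * √(2 ^ m) ≤ 2 * X := by
    have : √((2 : ℝ) ^ m) ≤ 2 * √(T : ℝ) := by
      rw [Real.sqrt_le_left (by positivity), mul_pow, Real.sq_sqrt (by linarith)]
      linarith
    calc _ ≤ ‖comparatorAverage T u‖ * (2 * √(T : ℝ)) := by gcongr
      _ = 2 * X := by rw [hX]; ring
  -- The average of the deviation over a block need not vanish; its cost `√Q` fits under `√(KĒ)`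
  -- because either `K ≥ 1` or `Ē = 0`.
  have b2 : √Q ≤ Y := by
    refine Real.sqrt_le_sqrt (hQE.trans ?_)
    rcases Nat.eq_zero_or_pos (numSwitches T u) with h0 | h0
    · have : E = 0 := by
        rw [hE, ← sum_norm_sq_deviation]
        simp [deviation_eq_zero_of_numSwitches_eq_zero hT h0]
      simp [this]
    · exact le_mul_of_one_le_left hE0 (by rw [hK]; exact_mod_cast h0)
  have b3 : √((S.image fun i => i - o).card * Q) ≤ 2 * Y := by
    rw [Real.sqrt_le_left (by positivity), mul_pow, hY, Real.sq_sqrt (by positivity)]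
    have c1 : ((S.image fun i => i - o).card : ℝ) ≤ 2 * K := by
      rw [hK]
      exact_mod_cast Finset.card_image_le.trans hScard
    have c2 := mul_le_mul c1 hQE hQ0 (by positivity)
    nlinarith [mul_nonneg (by positivity : 0 ≤ K) hE0]
  have b4 : (m : ℝ) * √((S.image fun i => i - o).card * Q) ≤ 4 * P * Y := by
    calc _ ≤ (2 * P) * (2 * Y) := mul_le_mul hmP b3 (Real.sqrt_nonneg _) (by linarith)
      _ = 4 * P * Y := by ring
  have b5 : ‖comparatorAverage T u‖ * √(2 ^ m) + √Q + m * √((S.image fun i => i - o).card * Q)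
      ≤ 6 * P * (X + Y) := by
    nlinarith [mul_le_mul_of_nonneg_right hP1 hX0, mul_le_mul_of_nonneg_right hP1 hY0]
  have b6 : 4 * G * (1 + 6 * P) ≤ 28 * G * P := by nlinarith
  have b7 := mul_le_mul b6 b5 (by positivity) (by positivity)
  linarith

theorem anytimeHaarOLR_regret {G : ℝ} (hG : 0 < G) {g : ℕ → Vec d} (hg : ∀ i, ‖g i‖ ≤ G)
    {T : ℕ} (hT : 1 ≤ T) (u : ℕ → Vec d) :
    ∑ i ∈ Finset.range T, inner ℝ (g i)
      (anytimeHaarOLR G ((List.range i).map g) - u (i + 1)) ≤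
    336 * G * Real.log (T + 1) + 336 * G * (‖comparatorAverage T u‖ * √(T : ℝ)
      + √((numSwitches T u : ℝ) * secondOrderVariability T u))
        * (1 + Real.log T + Real.log (1 + maxRange T u)) ^ 3 := by
  set P := 1 + Real.log T + Real.log (1 + maxRange T u) with hP
  set X := ‖comparatorAverage T u‖ * √(T : ℝ)
      + √((numSwitches T u : ℝ) * secondOrderVariability T u) with hX
  have hX0 : 0 ≤ X := by positivity
  have hT1 : (1 : ℝ) ≤ T := by exact_mod_cast hT
  have hM0 : (0 : ℝ) ≤ maxRange T u := (maxRange T u).coe_nonneg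
  have hlogM := Real.log_nonneg (by linarith : (1 : ℝ) ≤ 1 + maxRange T u)
  have hP1 : 1 ≤ P := by linarith [Real.log_nonneg hT1]
  have hlog1 : Real.log (T + 1) ≤ P := by
    have h1 : Real.log (T + 1) ≤ Real.log (2 * T) := Real.log_le_log (by linarith) (by linarith)
    rw [Real.log_mul (by norm_num) (by linarith)] at h1
    linarith [Real.log_two_lt_d9]
  -- The number of blocks started by round `T`: block `m` starts after `2 ^ m - 2` rounds, so it is
  -- reached exactly when `2 ^ m ≤ T + 1`.
  set B := Nat.log 2 (T + 1) with hB
  have hBlog : (B : ℝ) ≤ 2 * Real.log (T + 1) := by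
    have h1 : ((2 : ℝ) ^ B) ≤ T + 1 := by exact_mod_cast Nat.pow_log_le_self 2 (by omega)
    have h2 := Real.log_le_log (by positivity) h1
    rw [Real.log_pow] at h2
    nlinarith [Real.log_two_gt_d9, (Nat.cast_nonneg B : (0 : ℝ) ≤ B)]
  set R := G + 168 * G * P ^ 2 * X with hR
  have hR0 : 0 ≤ R := by positivity
  -- The first `b` blocks end after `2 ^ (b + 1) - 2` rounds; the minimum with `T` truncates the
  -- last one.
  have hblocks : ∀ b ≤ B, ∑ i ∈ Finset.range (min T (2 ^ (b + 1) - 2)), inner ℝ (g i)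
      (anytimeHaarOLR G ((List.range i).map g) - u (i + 1)) ≤ b * R := by
    intro b hb
    induction b with
    | zero => simp
    | succ b ih =>
      have ih' := ih (by omega)
      have h2 : 2 ≤ 2 ^ (b + 1) := by
        simpa using Nat.pow_le_pow_right (n := 2) (by norm_num) (Nat.le_add_left 1 b)
      have hpow : 2 ^ (b + 1) ≤ T + 1 :=
        (Nat.pow_le_pow_right (by norm_num) hb).trans (Nat.pow_log_le_self 2 (by omega))
      have ho : min T (2 ^ (b + 1) - 2) = 2 ^ (b + 1) - 2 := by omega
      rw [ho] at ih'
      have hsplit : min T (2 ^ (b + 1 + 1) - 2) = 2 ^ (b + 1) - 2 +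
          min (T - (2 ^ (b + 1) - 2)) (2 ^ (b + 1)) := by
        rw [pow_succ 2 (b + 1)]
        omega
      rw [hsplit, Finset.sum_range_add]
      have hcast : ((b + 1 : ℕ) : ℝ) ≤ B := by exact_mod_cast hb
      have := anytimeHaarOLR_block_regret hG hg hT u (m := b + 1)
        (n := min (T - (2 ^ (b + 1) - 2)) (2 ^ (b + 1))) (by omega) hpow (by omega) (by omega) hP
        (by linarith)
      push_cast
      linarith
  have hfin := hblocks B le_rfl
  have hlt : T + 1 < 2 ^ (B + 1) := Nat.lt_pow_succ_log_self (by norm_num) _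
  rw [min_eq_left (by omega)] at hfin
  refine hfin.trans ?_
  have hlog0 : 0 ≤ Real.log (T + 1) := Real.log_nonneg (by linarith)
  have h1 : (B : ℝ) * G ≤ 336 * G * Real.log (T + 1) := by nlinarith [mul_nonneg hG.le hlog0]
  have h2 : (B : ℝ) * (168 * G * P ^ 2 * X) ≤ 2 * P * (168 * G * P ^ 2 * X) := by
    refine mul_le_mul_of_nonneg_right ?_ (by positivity)
    linarith
  have h3 : 2 * P * (168 * G * P ^ 2 * X) = 336 * G * X * P ^ 3 := by ring
  rw [hR, mul_add]
  linarith

end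

theorem theorem2 :
    ∃ (C : ℝ) (k : ℕ), ∀ (d : ℕ) (G : NNReal), 0 < G →
      ∀ (T : ℕ), 1 ≤ T → ∀ (u : ℕ → Vec d),
        dynamicRegret (anytimeHaarOLR (d := d) (G : ℝ)) G T u ≤
          ((C * G * Real.log (T + 1)
            + C * G * (‖comparatorAverage T u‖ * √(T : ℝ)
                + √((numSwitches T u : ℝ) * secondOrderVariability T u))
              * (1 + Real.log T + Real.log (1 + maxRange T u)) ^ k : ℝ) : EReal) := by
  -- `336 = 2 · 168` is the bound `B ≤ 2P` times the block constant; the exponent is `2` from each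
  -- block plus `1` from the number of blocks.
  refine ⟨336, 3, fun d G hG T hT u => iSup_le fun env => EReal.coe_le_coe_iff.2 ?_⟩
  exact (sum_roundLoss_sub_le _ env T u).trans
    (anytimeHaarOLR_regret (NNReal.coe_pos.2 hG) (fun i => env.norm_grad_le _ _) hT u)
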